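/- Let $\mathbf X = X_1, X_2, \ldots$ be a stationary ergodic process, defined on a probability space $(\Omega,\mathcal F,\mathbb P)$, such that each $X_i$ takes values in $[0,1]$, is Borel measurable and has distribution equal to Lebesgue measure $\lambda$ on $[0,1]$. (Ergodic means that every shift-invariant event of the process has probability $0$ or $1$.) For a countable family $\mathcal C$ of Borel subsets of $[0,1]$ and $m \ge 1$, put $$\Gamma_m(\mathcal C : \mathbf X) = \sup_{C\in\mathcal C}\left|\frac1m\sum_{i=1}^m I(X_i\in C) - \mathbb P(X_1\in C)\right|,$$ with the convention that the supremum over the empty family is $0$. The join $A_1\vee\cdots\vee A_k$ of sets $A_1,\ldots,A_k\subseteq[0,1]$ is the collection of all nonempty intersections $\tilde A_1\cap\cdots\cap\tilde A_k$ with $\tilde A_i\in\{A_i, A_i^c\}$ for each $i$, where $A_i^c=[0,1]\setminus A_i$; its elements are called cells, and the join is full if it has exactly $2^k$ cells. The VC dimension of a family $\mathcal C$ of subsets of $[0,1]$ is the supremum of the cardinalities $|D|$ of the finite sets $D\subseteq[0,1]$ for which $|\{C\cap D : C\in\mathcal C\}| = 2^{|D|}$. Let $\mathcal C_0$ be a countable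 family of subsets of $[0,1]$, each of whose elements is a finite union of intervals. Suppose that $$\limsup_{m\to\infty}\Gamma_m(\mathcal C_0 : \mathbf X) > 0$$ with positive probability. Then, for each integer $L\ge 1$, there exist sets $D_1,\ldots,D_L\in\mathcal C_0$ such that the join $D_1\vee\cdots\vee D_L$ is full and each of its cells has positive Lebesgue measure. Consequently, $\mathcal C_0$ has infinite VC dimension. -/

import Mathlib

open MeasureTheory Filter Topology
open scoped unitInterval

namespace UniformErgodic

noncomputable section

/-- The left shift `(x₀, x₁, x₂, …) ↦ (x₁, x₂, x₃, …)` on one-sided sequences. -/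
def shift {S : Type*} (x : ℕ → S) : ℕ → S := fun n => x (n + 1)

/-- The law on path space of the process `X 0, X 1, X 2, …`. -/
def pathLaw {Ω S : Type*} [MeasurableSpace Ω] [MeasurableSpace S]
    (X : ℕ → Ω → S) (P : Measure Ω) : Measure (ℕ → S) :=
  P.map (fun ω n => X n ω)

/-- The process is stationary: its law is preserved by the shift. -/
def IsStationary {Ω S : Type*} [MeasurableSpace Ω] [MeasurableSpace S]
    (X : ℕ → Ω → S) (P : Measure Ω) : Prop :=
  MeasurePreserving shift (pathLaw X P) (pathLaw X P)

/-- The process is ergodic: its law is trivial on the sigma-field of measurable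
shift-invariant sets of sequences. -/
def IsErgodic {Ω S : Type*} [MeasurableSpace Ω] [MeasurableSpace S]
    (X : ℕ → Ω → S) (P : Measure Ω) : Prop :=
  PreErgodic shift (pathLaw X P)

/-- `| (1/m) ∑_{i=1}^m 1(X_i(ω) ∈ C) - P(X ∈ C) |`, where `X` has the law of the first variable
of the process; the process is indexed from `0`. -/
def discrepancy {Ω S : Type*} [MeasurableSpace Ω]
    (X : ℕ → Ω → S) (P : Measure Ω) (C : Set S) (m : ℕ) (ω : Ω) : ℝ :=
  |(1 / (m : ℝ)) * ∑ i ∈ Finset.range m, C.indicator (fun _ => (1 : ℝ)) (X i ω)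
    - P.real {ω' | X 0 ω' ∈ C}|

/-- `Γ_m(𝒞 : X)`, the supremum of the discrepancies over the family `𝒞`. For `m ≥ 1` the
discrepancies lie in `[0, 1]`. -/
def Gamma {Ω S : Type*} [MeasurableSpace Ω]
    (𝒞 : Set (Set S)) (X : ℕ → Ω → S) (P : Measure Ω) (m : ℕ) (ω : Ω) : ℝ :=
  ⨆ C : 𝒞, discrepancy X P (C : Set S) m ω

/-- A set is a finite union of intervals; `Set.OrdConnected` sets of `[0, 1]` are precisely its
intervals (open, closed or half-open, possibly empty or reduced to a point). -/
def IsFiniteUnionOfIntervals {S : Type*} [Preorder S] (C : Set S) : Prop :=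
  ∃ 𝒥 : Set (Set S), 𝒥.Finite ∧ (∀ J ∈ 𝒥, J.OrdConnected) ∧ C = ⋃₀ 𝒥

/-- The join of `A 0, …, A (k - 1)`: the collection of all nonempty intersections
`B 0 ∩ ⋯ ∩ B (k - 1)` where each `B i` is `A i` or its complement. -/
def join {S : Type*} {k : ℕ} (A : Fin k → Set S) : Set (Set S) :=
  {E | E.Nonempty ∧ ∃ B : Fin k → Set S, (∀ i, B i = A i ∨ B i = (A i)ᶜ) ∧ E = ⋂ i, B i}

/-- The join is full: it has the maximal cardinality `2 ^ k`. -/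
def IsFullJoin {S : Type*} {k : ℕ} (A : Fin k → Set S) : Prop :=
  (join A).ncard = 2 ^ k

/-- The shatter coefficient: the number of distinct sets `C ∩ D`, `C ∈ 𝒞`. -/
def shatterCoeff {S : Type*} (D : Finset S) (𝒞 : Set (Set S)) : ℕ :=
  ((fun C : Set S => C ∩ (D : Set S)) '' 𝒞).ncard

/-- The Vapnik-Chervonenkis dimension: the supremum in `ℕ∞` of the cardinalities of the finite
sets `D` that `𝒞` shatters. -/
def vcDim {S : Type*} (𝒞 : Set (Set S)) : ℕ∞ :=
  ⨆ (D : Finset S) (_ : shatterCoeff D 𝒞 = 2 ^ D.card), (D.card : ℕ∞)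

end

end UniformErgodic

/-! Record each sample size `m` and index `k` by its `profile`: the frequency and the measure of `C
k ∩ A`, for all sets `A`. Profiles live in a compact product of squares. If discrepancies of size
`δ` persist, compactness and a zero-one law yield one deterministic cluster profile `z` whose two
coordinates differ by at least `δ` at the whole space (`exists_isClusterProfile`). Both coordinates
of `z` are finitely additive and dominated by `μ`; for the frequencies this is the ergodic theorem.
Their difference is thus a signed measure, and a Hahn decomposition gives a non-null `E` such that
the coordinates differ on every non-null measurable subset of `E`. Such a subset `A` is split by
some `C k` (`IsClusterProfile.exists_split`). If `C k ∩ A` were null, its frequency and its measure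
would both vanish; if `A \ C k` were null, both would be near `μ A`; either contradicts the gap in
`z`. One `k` serves finitely many sets at once, so all cells can be split repeatedly within `E`.
Duality turns `2 ^ L` sets with nonempty cells into `L` shattered points. -/

namespace UniformErgodic

/-! ### Zero-one law -/

/-- A zero-one law for almost invariant sequences: if `u n k` changes by at most `b n → 0` along
`T`, then the threshold `ε` is undercut infinitely often with probability `0` or `1`, up to
lowering `ε`. -/
lemma ae_frequently_lt_or_ae_eventually_le {α κ : Type*} [MeasurableSpace α] [Countable κ]
    {Q : Measure α} {T : α → α} (hT : PreErgodic T Q) {u : ℕ → κ → α → ℝ}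
    (hu : ∀ n k, Measurable (u n k)) {b : ℕ → ℝ} (hb : Tendsto b atTop (𝓝 0))
    (hub : ∀ n k x, |u n k (T x) - u n k x| ≤ b n) (ε : ℝ) :
    (∀ᵐ x ∂Q, ∃ᶠ n in atTop, ∃ k, u n k x < ε) ∨
      ∀ᵐ x ∂Q, ∀ q : ℚ, (q : ℝ) < ε → ∀ᶠ n in atTop, ∀ k, (q : ℝ) ≤ u n k x := by
  -- The rational slack below `ε` absorbs the perturbation `b n`, which makes `V` exactly invariant.
  set V : Set α := {x | ∃ q : ℚ, (q : ℝ) < ε ∧ ∃ᶠ n in atTop, ∃ k, u n k x < q} with hV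
  have hVm : MeasurableSet V := by
    have : V = ⋃ q : ℚ, ⋃ _ : (q : ℝ) < ε, ⋂ N : ℕ, ⋃ n : ℕ, ⋃ _ : N ≤ n, ⋃ k,
        {x | u n k x < q} := by
      ext x
      simp [hV, frequently_atTop]
    rw [this]
    refine .iUnion fun q => .iUnion fun _ => .iInter fun N => .iUnion fun n => .iUnion fun _ =>
      .iUnion fun k => measurableSet_lt (hu n k) measurable_const
  have key : ∀ x y, (∀ n k, |u n k x - u n k y| ≤ b n) → x ∈ V → y ∈ V := by
    rintro x y hxy ⟨q, hq, hx⟩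
    obtain ⟨r, hqr, hr⟩ := exists_rat_btwn hq
    refine ⟨r, hr, ?_⟩
    have hsmall : ∀ᶠ n in atTop, b n < r - q := hb.eventually (gt_mem_nhds (by linarith))
    refine (hx.and_eventually hsmall).mono ?_
    rintro n ⟨⟨k, hk⟩, hn⟩
    exact ⟨k, by have := (abs_le.1 (hxy n k)).1; linarith⟩
  have hinv : T ⁻¹' V = V := by
    ext x
    exact ⟨key _ _ fun n k => hub n k x,
      key _ _ fun n k => by rw [abs_sub_comm]; exact hub n k x⟩
  rcases hT.ae_mem_or_ae_notMem hVm hinv with h | h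
  · left
    filter_upwards [h] with x ⟨q, hq, hx⟩
    exact hx.mono fun n ⟨k, hk⟩ => ⟨k, hk.trans hq⟩
  · right
    filter_upwards [h] with x hx q hq
    by_contra hcon
    refine hx ⟨q, hq, ?_⟩
    rw [not_eventually] at hcon
    exact hcon.mono fun n hn => by push Not at hn; exact hn

/-! ### Maximal ergodic inequality -/

/-- The running maximum of the Birkhoff sums of `g` up to time `N`, including the empty sum. -/
noncomputable def maxBirkhoffSum {α : Type*} (T : α → α) (g : α → ℝ) : ℕ → α → ℝ
  | 0, _ => 0
  | N + 1, x => max 0 (g x + maxBirkhoffSum T g N (T x))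

section MaximalInequality

variable {α : Type*} {T : α → α} {g : α → ℝ}

lemma maxBirkhoffSum_nonneg (N : ℕ) (x : α) : 0 ≤ maxBirkhoffSum T g N x := by
  cases N with
  | zero => exact le_rfl
  | succ N => exact le_max_left _ _

lemma maxBirkhoffSum_le_succ (N : ℕ) : ∀ x : α,
    maxBirkhoffSum T g N x ≤ maxBirkhoffSum T g (N + 1) x := by
  induction N with
  | zero => exact fun x => maxBirkhoffSum_nonneg _ _
  | succ N ih => exact fun x => max_le_max le_rfl (add_le_add le_rfl (ih _))

lemma birkhoffSum_le_maxBirkhoffSum (N : ℕ) : ∀ x : α,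
    birkhoffSum T g N x ≤ maxBirkhoffSum T g N x := by
  induction N with
  | zero => intro x; simp [maxBirkhoffSum]
  | succ N ih =>
    intro x
    rw [birkhoffSum_succ']
    exact (add_le_add le_rfl (ih _)).trans (le_max_right _ _)

variable [MeasurableSpace α] {Q : Measure α}

lemma measurable_maxBirkhoffSum (hT : Measurable T) (hg : Measurable g) (N : ℕ) :
    Measurable (maxBirkhoffSum T g N) := by
  induction N with
  | zero => exact measurable_const
  | succ N ih => exact measurable_const.max (hg.add (ih.comp hT))

lemma integrable_maxBirkhoffSum (hT : MeasurePreserving T Q Q) (hg : Integrable g Q)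
    (N : ℕ) : Integrable (maxBirkhoffSum T g N) Q := by
  induction N with
  | zero => exact integrable_zero _ _ _
  | succ N ih => exact (integrable_zero α ℝ Q).sup (hg.add (hT.integrable_comp_of_integrable ih))

/-- Garsia's argument: with `M` the running maximum, `M - M ∘ T` is at most `g` where `M > 0` and at
most `0` elsewhere, while its integral vanishes by invariance. -/
lemma setIntegral_maxBirkhoffSum_pos_nonneg (hT : MeasurePreserving T Q Q) (hgm : Measurable g)
    (hg : Integrable g Q) (N : ℕ) : 0 ≤ ∫ x in {x | 0 < maxBirkhoffSum T g N x}, g x ∂Q := by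
  set M := maxBirkhoffSum T g N with hM
  have hMm : Measurable M := measurable_maxBirkhoffSum hT.measurable hgm N
  have hMi : Integrable M Q := integrable_maxBirkhoffSum hT hg N
  have hMTi : Integrable (fun x => M (T x)) Q := hT.integrable_comp_of_integrable hMi
  have hs : MeasurableSet {x | 0 < M x} := measurableSet_lt measurable_const hMm
  have hMT : ∫ x, M (T x) ∂Q = ∫ x, M x ∂Q := by
    conv_rhs => rw [← hT.map_eq]
    exact (integral_map hT.measurable.aemeasurable
      hMm.aestronglyMeasurable).symm
  have hpt : ∫ x, (M x - M (T x)) ∂Q ≤ ∫ x, {x | 0 < M x}.indicator g x ∂Q := by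
    refine integral_mono (hMi.sub hMTi) (hg.indicator hs) fun x => ?_
    by_cases hx : 0 < M x
    · have h1 : M x ≤ max 0 (g x + M (T x)) := maxBirkhoffSum_le_succ N x
      have h2 : M x ≤ g x + M (T x) := by
        rcases le_max_iff.1 h1 with h | h
        · exact absurd h (not_le.2 hx)
        · exact h
      rw [Set.indicator_of_mem (by exact hx)]
      simp only
      linarith
    · rw [Set.indicator_of_notMem (by exact hx)]
      have := maxBirkhoffSum_nonneg (T := T) (g := g) N (T x)
      simp only
      rw [← hM] at this
      linarith
  rw [integral_sub hMi hMTi, hMT, sub_self, integral_indicator hs] at hpt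
  exact hpt

/-- A form of the maximal ergodic theorem. -/
lemma integral_nonneg_of_ae_exists_birkhoffSum_pos (hT : MeasurePreserving T Q Q)
    (hgm : Measurable g) (hg : Integrable g Q)
    (h : ∀ᵐ x ∂Q, ∃ n, 0 < birkhoffSum T g n x) : 0 ≤ ∫ x, g x ∂Q := by
  set s : ℕ → Set α := fun N => {x | 0 < maxBirkhoffSum T g N x} with hs
  have hsm : ∀ N, MeasurableSet (s N) := fun N =>
    measurableSet_lt measurable_const (measurable_maxBirkhoffSum hT.measurable hgm N)
  have hmono : Monotone s := monotone_nat_of_le_succ fun N x (hx : 0 < _) =>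
    lt_of_lt_of_le hx (maxBirkhoffSum_le_succ N x)
  have hlim := tendsto_setIntegral_of_monotone hsm hmono hg.integrableOn
  have huniv : ∫ x in ⋃ N, s N, g x ∂Q = ∫ x, g x ∂Q := by
    rw [← integral_indicator (.iUnion hsm)]
    refine integral_congr_ae ?_
    filter_upwards [h] with x ⟨n, hn⟩
    exact Set.indicator_of_mem
      (Set.mem_iUnion.2 ⟨n, hn.trans_le (birkhoffSum_le_maxBirkhoffSum n x)⟩) g
  rw [huniv] at hlim
  exact ge_of_tendsto' hlim fun N => setIntegral_maxBirkhoffSum_pos_nonneg hT hgm hg N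

end MaximalInequality

/-! ### Pointwise ergodic theorem -/

section Birkhoff

lemma abs_birkhoffAverage_apply_sub_le {α : Type*} {T : α → α} {f : α → ℝ} {B : ℝ} (hB : ∀ x, |f x| ≤ B) (n : ℕ) (x : α) :
    |birkhoffAverage ℝ T f n (T x) - birkhoffAverage ℝ T f n x| ≤ 2 * B / n := by
  rw [birkhoffAverage_apply_sub_birkhoffAverage, smul_eq_mul, abs_mul, abs_inv, Nat.abs_cast,
    div_eq_inv_mul]
  refine mul_le_mul_of_nonneg_left ?_ (by positivity)
  calc |f (T^[n] x) - f x| ≤ |f (T^[n] x)| + |f x| := abs_sub _ _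
    _ ≤ 2 * B := by linarith [hB (T^[n] x), hB x]

variable {α : Type*} [MeasurableSpace α] {Q : Measure α} [IsProbabilityMeasure Q] {T : α → α}
  {f : α → ℝ}

lemma measurable_birkhoffAverage (hT : Measurable T) (hf : Measurable f) (n : ℕ) :
    Measurable (birkhoffAverage ℝ T f n) := by
  have h : Measurable (birkhoffSum T f n) :=
    Finset.measurable_sum _ fun i _ => hf.comp (hT.iterate i)
  exact h.const_smul (n : ℝ)⁻¹

/-- By the zero-one law, failure would make the averages exceed some `r > ∫ f` infinitely often
almost everywhere; the maximal inequality for `f - r` then forces `∫ f ≥ r`. -/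
lemma ae_eventually_birkhoffAverage_le (hT : Ergodic T Q) (hf : Measurable f) {B : ℝ}
    (hB : ∀ x, |f x| ≤ B) {c : ℝ} (hc : ∫ x, f x ∂Q < c) :
    ∀ᵐ x ∂Q, ∀ᶠ n in atTop, birkhoffAverage ℝ T f n x ≤ c := by
  have hfi : Integrable f Q := .of_bound hf.aestronglyMeasurable B (.of_forall hB)
  obtain ⟨r, hr, hrc⟩ := exists_rat_btwn hc
  obtain ⟨q, hrq, hqc⟩ := exists_rat_btwn hrc
  have h01 := ae_frequently_lt_or_ae_eventually_le hT.toPreErgodic (κ := Unit)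
    (u := fun n _ x => -birkhoffAverage ℝ T f n x)
    (fun n _ => (measurable_birkhoffAverage hT.measurable hf n).neg)
    (b := fun n : ℕ => 2 * B / n) (tendsto_const_div_atTop_nhds_zero_nat _)
    (fun n _ x => by
      rw [neg_sub_neg, abs_sub_comm]
      exact abs_birkhoffAverage_apply_sub_le hB n x) (-r)
  rcases h01 with h | h
  · exfalso
    have hg : Integrable (fun x => f x - r) Q := hfi.sub (integrable_const _)
    have := integral_nonneg_of_ae_exists_birkhoffSum_pos hT.toMeasurePreserving
      (hf.sub_const (r : ℝ)) hg (by
        filter_upwards [h] with x hx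
        obtain ⟨n, ⟨_, hn⟩, hn0⟩ := (hx.and_eventually (eventually_gt_atTop 0)).exists
        refine ⟨n, ?_⟩
        have hn0' : (0 : ℝ) < n := by exact_mod_cast hn0
        have h1 : (r : ℝ) < (n : ℝ)⁻¹ * birkhoffSum T f n x := by
          have : birkhoffAverage ℝ T f n x = (n : ℝ)⁻¹ * birkhoffSum T f n x := rfl
          linarith
        have h2 : birkhoffSum T (fun x => f x - r) n x = birkhoffSum T f n x - n * r := by
          simp [birkhoffSum, Finset.sum_sub_distrib]
        rw [h2, sub_pos]
        rwa [← div_eq_inv_mul, lt_div_iff₀ hn0', mul_comm] at h1)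
    rw [integral_sub hfi (integrable_const _)] at this
    simp at this
    linarith
  · filter_upwards [h] with x hx
    filter_upwards [hx (-q) (by push_cast; linarith)] with n hn
    have := hn ()
    push_cast at this
    linarith

/-- The pointwise ergodic theorem for bounded functions. -/
theorem ae_tendsto_birkhoffAverage (hT : Ergodic T Q) (hf : Measurable f) {B : ℝ}
    (hB : ∀ x, |f x| ≤ B) :
    ∀ᵐ x ∂Q, Tendsto (fun n => birkhoffAverage ℝ T f n x) atTop (𝓝 (∫ x, f x ∂Q)) := by
  have hup : ∀ᵐ x ∂Q, ∀ c : ℚ, ∫ x, f x ∂Q < c →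
      ∀ᶠ n in atTop, birkhoffAverage ℝ T f n x ≤ c :=
    ae_all_iff.2 fun c => eventually_imp_distrib_left.2 fun hc => ae_eventually_birkhoffAverage_le hT hf hB hc
  have hdown : ∀ᵐ x ∂Q, ∀ c : ℚ, c < ∫ x, f x ∂Q →
      ∀ᶠ n in atTop, (c : ℝ) ≤ birkhoffAverage ℝ T f n x := by
    refine ae_all_iff.2 fun c => eventually_imp_distrib_left.2 fun hc => ?_
    have := ae_eventually_birkhoffAverage_le (f := fun x => -f x) hT hf.neg (B := B)
      (fun x => by rw [abs_neg]; exact hB x) (c := -c) (by rw [integral_neg]; linarith)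
    filter_upwards [this] with x hx
    filter_upwards [hx] with n hn
    have h2 : birkhoffAverage ℝ T (fun x => -f x) n x = -birkhoffAverage ℝ T f n x := by
      simp [birkhoffAverage, birkhoffSum]
    linarith
  filter_upwards [hup, hdown] with x h1 h2
  refine tendsto_order.2 ⟨fun a ha => ?_, fun a ha => ?_⟩
  · obtain ⟨c, hac, hc⟩ := exists_rat_btwn ha
    exact (h2 c hc).mono fun n hn => hac.trans_le hn
  · obtain ⟨c, hc, hca⟩ := exists_rat_btwn ha
    exact (h1 c hc).mono fun n hn => hn.trans_lt hca

end Birkhoff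

/-! ### Empirical frequencies -/

section EmpiricalFrequency

variable {S : Type*}

/-- The relative frequency of `A` among the first `m` terms of `x`. -/
noncomputable def empFreq (A : Set S) (m : ℕ) (x : ℕ → S) : ℝ :=
  (1 / (m : ℝ)) * ∑ i ∈ Finset.range m, A.indicator (fun _ => (1 : ℝ)) (x i)

lemma shift_iterate_apply (n : ℕ) : ∀ (x : ℕ → S) (i : ℕ), shift^[n] x i = x (i + n) := by
  induction n with
  | zero => intro x i; rfl
  | succ n ih =>
    intro x i
    rw [Function.iterate_succ_apply, ih]
    exact congrArg x (by omega)

lemma empFreq_eq_birkhoffAverage (A : Set S) (m : ℕ) (x : ℕ → S) :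
    empFreq A m x = birkhoffAverage ℝ shift
      (fun y : ℕ → S => A.indicator (fun _ => (1 : ℝ)) (y 0)) m x := by
  simp [empFreq, birkhoffAverage, birkhoffSum, shift_iterate_apply]

lemma abs_indicator_one_le (A : Set S) (s : S) : |A.indicator (fun _ => (1 : ℝ)) s| ≤ 1 := by
  by_cases h : s ∈ A <;> simp [h]

lemma abs_empFreq_shift_sub_le (A : Set S) (m : ℕ) (x : ℕ → S) :
    |empFreq A m (shift x) - empFreq A m x| ≤ 2 / m := by
  rw [empFreq_eq_birkhoffAverage, empFreq_eq_birkhoffAverage]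
  simpa using abs_birkhoffAverage_apply_sub_le (T := shift) (B := 1)
    (f := fun y : ℕ → S => A.indicator (fun _ => (1 : ℝ)) (y 0))
    (fun y => abs_indicator_one_le A _) m x

lemma empFreq_nonneg (A : Set S) (m : ℕ) (x : ℕ → S) : 0 ≤ empFreq A m x :=
  mul_nonneg (by positivity)
    (Finset.sum_nonneg fun i _ => Set.indicator_nonneg (fun _ _ => zero_le_one) _)

lemma empFreq_mono {A B : Set S} (h : A ⊆ B) (m : ℕ) (x : ℕ → S) :
    empFreq A m x ≤ empFreq B m x :=
  mul_le_mul_of_nonneg_left (Finset.sum_le_sum fun i _ =>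
    Set.indicator_le_indicator_of_subset h (fun _ => zero_le_one) _) (by positivity)

lemma empFreq_le_one (A : Set S) (m : ℕ) (x : ℕ → S) : empFreq A m x ≤ 1 := by
  refine (empFreq_mono (Set.subset_univ A) m x).trans ?_
  rcases Nat.eq_zero_or_pos m with rfl | hm
  · simp [empFreq]
  · have : (m : ℝ) ≠ 0 := by positivity
    simp [empFreq, this]

lemma empFreq_union {A B : Set S} (h : Disjoint A B) (m : ℕ) (x : ℕ → S) :
    empFreq (A ∪ B) m x = empFreq A m x + empFreq B m x := by
  simp only [empFreq, Set.indicator_union_of_disjoint h, Finset.sum_add_distrib, mul_add]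

lemma empFreq_eq_zero {A : Set S} {x : ℕ → S} (h : ∀ i, x i ∉ A) (m : ℕ) :
    empFreq A m x = 0 := by
  simp [empFreq, h]

variable [MeasurableSpace S]

lemma measurable_empFreq {A : Set S} (hA : MeasurableSet A) (m : ℕ) :
    Measurable (empFreq A m) :=
  (Finset.measurable_sum _ fun i _ =>
    (measurable_const.indicator hA).comp (measurable_pi_apply i)).const_mul _

lemma ae_tendsto_empFreq {Q : Measure (ℕ → S)} [IsProbabilityMeasure Q] (hQ : Ergodic shift Q)
    {μ : Measure S} (hμ : ∀ i, Q.map (fun x => x i) = μ) {A : Set S} (hA : MeasurableSet A) :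
    ∀ᵐ x ∂Q, Tendsto (fun m => empFreq A m x) atTop (𝓝 (μ.real A)) := by
  have hm : Measurable (fun s => A.indicator (fun _ => (1 : ℝ)) s) :=
    measurable_const.indicator hA
  have h := ae_tendsto_birkhoffAverage hQ (B := 1)
    (f := fun y : ℕ → S => A.indicator (fun _ => (1 : ℝ)) (y 0))
    (hm.comp (measurable_pi_apply 0)) (fun y => abs_indicator_one_le A _)
  have hint : ∫ y, A.indicator (fun _ => (1 : ℝ)) (y 0) ∂Q = μ.real A := by
    rw [← hμ 0, ← integral_indicator_one hA,
      integral_map (measurable_pi_apply 0).aemeasurable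
        (measurable_one.indicator hA).aestronglyMeasurable]
    rfl
  rw [hint] at h
  simpa only [empFreq_eq_birkhoffAverage] using h

lemma ae_forall_apply_notMem {Q : Measure (ℕ → S)} {μ : Measure S}
    (hμ : ∀ i, Q.map (fun x => x i) = μ) {A : Set S} (hA : μ A = 0) :
    ∀ᵐ x ∂Q, ∀ i, x i ∉ A := by
  refine ae_all_iff.2 fun i => ?_
  have h : ∀ᵐ s ∂(Q.map fun x : ℕ → S => x i), s ∉ A := by
    rw [hμ i]
    exact measure_eq_zero_iff_ae_notMem.1 hA
  exact ae_of_ae_map (measurable_pi_apply i).aemeasurable h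

end EmpiricalFrequency

/-! ### Cluster points of frequency-measure pairs -/

section ClusterProfile

variable {S κ : Type*} [MeasurableSpace S]

/-- The pair of set functions `A ↦ (frequency of C k ∩ A, measure of C k ∩ A)`. -/
noncomputable def profile (μ : Measure S) (C : κ → Set S) (m : ℕ) (k : κ) (x : ℕ → S)
    (A : Set S) : ℝ × ℝ :=
  (empFreq (C k ∩ A) m x, μ.real (C k ∩ A))

/-- `z` is almost surely a pointwise limit, on measurable sets, of profiles of members of the
family as the sample size tends to infinity. -/
def IsClusterProfile (Q : Measure (ℕ → S)) (μ : Measure S) (C : κ → Set S)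
    (z : Set S → ℝ × ℝ) : Prop :=
  ∀ F : Finset (Set S), (∀ A ∈ F, MeasurableSet A) → ∀ ε > 0,
    ∀ᵐ x ∂Q, ∃ᶠ m in atTop, ∃ k, ∑ A ∈ F, dist (profile μ C m k x A) (z A) < ε

/-- Otherwise each point of the compact set `K` has a neighbourhood that profiles almost surely
eventually avoid. A finite subcover keeps them out of `K` altogether, so all discrepancies are
eventually below `δ`. -/
lemma exists_isClusterProfile [Countable κ] {Q : Measure (ℕ → S)} (hQ : PreErgodic shift Q)
    {μ : Measure S} [IsProbabilityMeasure μ] {C : κ → Set S} (hC : ∀ k, MeasurableSet (C k))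
    {δ : ℝ} (hδ : ¬ ∀ᵐ x ∂Q, ∀ᶠ m in atTop, ∀ k, |empFreq (C k) m x - μ.real (C k)| < δ) :
    ∃ z, IsClusterProfile Q μ C z ∧ δ ≤ |(z Set.univ).1 - (z Set.univ).2| := by
  by_contra! hcon
  set K : Set (Set S → ℝ × ℝ) :=
    Set.pi Set.univ (fun _ => Set.Icc 0 1 ×ˢ Set.Icc 0 1) ∩
      {z | δ ≤ |(z Set.univ).1 - (z Set.univ).2|} with hK
  have hKc : IsCompact K := by
    refine (isCompact_univ_pi fun _ => isCompact_Icc.prod isCompact_Icc).inter_right ?_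
    exact isClosed_le continuous_const (by fun_prop)
  have hloc : ∀ z ∈ K, ∃ (F : Finset (Set S)) (q : ℝ), 0 < q ∧
      ∀ᵐ x ∂Q, ∀ᶠ m in atTop, ∀ k, q ≤ ∑ A ∈ F, dist (profile μ C m k x A) (z A) := by
    intro z hz
    have hz' : ¬ IsClusterProfile Q μ C z := fun h => absurd hz.2 (not_le.2 (hcon z h))
    unfold IsClusterProfile at hz'
    push Not at hz'
    obtain ⟨F, hF, ε, hε, hnot⟩ := hz'
    obtain ⟨q, hq0, hq⟩ := exists_rat_btwn hε
    refine ⟨F, q, hq0, ?_⟩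
    -- Upgrades "not almost surely infinitely often close to `z`" to "almost surely eventually far
    -- from `z`". A shift moves each of the `F.card` distances by at most `2 / m`.
    have h01 := ae_frequently_lt_or_ae_eventually_le hQ
      (u := fun m k x => ∑ A ∈ F, dist (profile μ C m k x A) (z A))
      (fun m k => Finset.measurable_sum _ fun A hA =>
        ((measurable_empFreq ((hC k).inter (hF A hA)) m).prodMk measurable_const).dist
          measurable_const)
      (b := fun m : ℕ => (F.card * 2 : ℝ) / m) (tendsto_const_div_atTop_nhds_zero_nat _)
      (fun m k x => by
        rw [← Finset.sum_sub_distrib]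
        refine (Finset.abs_sum_le_sum_abs _ _).trans ?_
        rw [mul_div_assoc, ← nsmul_eq_mul]
        refine Finset.sum_le_card_nsmul _ _ _ fun A _ => (abs_dist_sub_le _ _ _).trans ?_
        rw [Prod.dist_eq]
        simp only [profile, dist_self]
        exact max_le (abs_empFreq_shift_sub_le _ m x) (by positivity)) ε
    rcases h01 with h | h
    · obtain ⟨x, hx1, hx2⟩ := (hnot.and_eventually h).exists
      obtain ⟨m, ⟨k, hk⟩, hm⟩ := (hx2.and_eventually hx1).exists
      exact absurd hk (not_lt.2 (hm k))
    · exact h.mono fun x hx => hx q hq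
  choose! F q hq0 hae using hloc
  obtain ⟨t, htK, ht⟩ := hKc.elim_nhds_subcover
    (fun z => {y | ∑ A ∈ F z, dist (y A) (z A) < q z}) (fun z hz => by
      refine IsOpen.mem_nhds (isOpen_lt (by fun_prop) continuous_const) ?_
      simpa using hq0 z hz)
  refine hδ ?_
  have hall : ∀ᵐ x ∂Q, ∀ z ∈ t, ∀ᶠ m in atTop, ∀ k,
      q z ≤ ∑ A ∈ F z, dist (profile μ C m k x A) (z A) :=
    (Finset.eventually_all t).2 fun z hz => hae z (htK z hz)
  filter_upwards [hall] with x hx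
  filter_upwards [(Finset.eventually_all t).2 hx] with m hm k
  by_contra! hlt
  have hmem : profile μ C m k x ∈ K := by
    refine ⟨fun A _ => ⟨⟨empFreq_nonneg _ _ _, empFreq_le_one _ _ _⟩,
      ⟨measureReal_nonneg, measureReal_le_one⟩⟩, ?_⟩
    simpa [profile] using hlt
  obtain ⟨z, hz, hlt'⟩ := Set.mem_iUnion₂.1 (ht hmem)
  exact absurd hlt' (not_lt.2 (hm z hz k))

/-- A cluster profile is approximated on finitely many sets by a single sample that is typical
for these sets and avoids the null pieces into which the family cuts them. -/
lemma IsClusterProfile.exists_sample [Countable κ] {Q : Measure (ℕ → S)} [IsProbabilityMeasure Q]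
    (hQ : Ergodic shift Q) {μ : Measure S} (hμ : ∀ i, Q.map (fun x => x i) = μ)
    {C : κ → Set S} {z : Set S → ℝ × ℝ} (hz : IsClusterProfile Q μ C z) (F : Finset (Set S))
    (hF : ∀ A ∈ F, MeasurableSet A) {ε : ℝ} (hε : 0 < ε) :
    ∃ (m : ℕ) (k : κ) (x : ℕ → S), ∀ A ∈ F,
      |empFreq (C k ∩ A) m x - (z A).1| < ε ∧ |μ.real (C k ∩ A) - (z A).2| < ε ∧
      |empFreq A m x - μ.real A| < ε ∧ (μ (C k ∩ A) = 0 → empFreq (C k ∩ A) m x = 0) ∧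
      (μ (A \ C k) = 0 → empFreq (A \ C k) m x = 0) := by
  have h1 : ∀ᵐ x ∂Q, ∀ A ∈ F, Tendsto (fun m => empFreq A m x) atTop (𝓝 (μ.real A)) :=
    (Finset.eventually_all F).2 fun A hA => ae_tendsto_empFreq hQ hμ (hF A hA)
  -- The index `k` will depend on `x`, so null pieces are excluded for all `k` at once; this uses
  -- countability of `κ`.
  have h2 : ∀ᵐ x ∂Q, ∀ A ∈ F, ∀ k,
      (μ (C k ∩ A) = 0 → ∀ i, x i ∉ C k ∩ A) ∧ (μ (A \ C k) = 0 → ∀ i, x i ∉ A \ C k) :=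
    (Finset.eventually_all F).2 fun A _ => ae_all_iff.2 fun k =>
      (eventually_imp_distrib_left.2 (ae_forall_apply_notMem hμ)).and
        (eventually_imp_distrib_left.2 (ae_forall_apply_notMem hμ))
  obtain ⟨x, hx, hx1, hx2⟩ := ((hz F hF ε hε).and (h1.and h2)).exists
  have h3 : ∀ᶠ m in atTop, ∀ A ∈ F, |empFreq A m x - μ.real A| < ε :=
    (Finset.eventually_all F).2 fun A hA => by
      simpa only [Real.dist_eq] using Metric.tendsto_nhds.1 (hx1 A hA) ε hε
  obtain ⟨m, ⟨k, hk⟩, hm⟩ := (hx.and_eventually h3).exists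
  refine ⟨m, k, x, fun A hA => ?_⟩
  have hd : dist (profile μ C m k x A) (z A) < ε :=
    (Finset.single_le_sum (f := fun A => dist (profile μ C m k x A) (z A))
      (fun _ _ => dist_nonneg) hA).trans_lt hk
  rw [Prod.dist_eq, max_lt_iff] at hd
  exact ⟨hd.1, hd.2, hm A hA, fun h => empFreq_eq_zero ((hx2 A hA k).1 h) m,
    fun h => empFreq_eq_zero ((hx2 A hA k).2 h) m⟩

end ClusterProfile

/-! ### Signed measures and Hahn decomposition -/

section AdditiveSetFunction

variable {S : Type*} [MeasurableSpace S] {μ : Measure S} [IsFiniteMeasure μ]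

/-- A finitely additive set function dominated by a finite measure is a signed measure. -/
lemma exists_signedMeasure_eq {θ : Set S → ℝ}
    (hadd : ∀ A B, MeasurableSet A → MeasurableSet B → Disjoint A B → θ (A ∪ B) = θ A + θ B)
    (hle : ∀ A, MeasurableSet A → |θ A| ≤ μ.real A) :
    ∃ ν : SignedMeasure S, ∀ A, MeasurableSet A → ν A = θ A := by
  classical
  have hempty : θ ∅ = 0 := by simpa using hle ∅ .empty
  have hfin : ∀ (f : ℕ → Set S), (∀ i, MeasurableSet (f i)) → Pairwise (Function.onFun Disjoint f) →
      ∀ s : Finset ℕ, θ (⋃ i ∈ s, f i) = ∑ i ∈ s, θ (f i) := by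
    intro f hf hd s
    induction s using Finset.induction_on with
    | empty => simpa using hempty
    | insert a s ha ih =>
      rw [Finset.set_biUnion_insert, Finset.sum_insert ha, ← ih]
      refine hadd _ _ (hf a) (s.measurableSet_biUnion fun i _ => hf i) ?_
      exact Set.disjoint_iUnion₂_right.2 fun i hi => hd (by rintro rfl; exact ha hi)
  refine ⟨⟨fun A => if MeasurableSet A then θ A else 0, by simp [hempty],
    fun A hA => if_neg hA, ?_⟩, fun A hA => if_pos hA⟩
  intro f hf hd
  have hU : MeasurableSet (⋃ i, f i) := .iUnion hf
  simp only [hf, hU, if_true]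
  have hμ : HasSum (fun i => μ.real (f i)) (μ.real (⋃ i, f i)) := by
    have h := μ.toSignedMeasure.m_iUnion hf hd
    simpa only [Measure.toSignedMeasure_apply_measurable (hf _),
      Measure.toSignedMeasure_apply_measurable hU] using h
  -- Countable additivity comes from domination: the remainder of `θ` is bounded by the `μ`-mass of
  -- the tail.
  have hμ0 : Tendsto (fun s : Finset ℕ => μ.real (⋃ i, f i) - ∑ i ∈ s, μ.real (f i)) atTop
      (𝓝 0) := by
    have h : Tendsto (fun s : Finset ℕ => ∑ i ∈ s, μ.real (f i)) atTop (𝓝 (μ.real (⋃ i, f i))) := hμ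
    simpa using h.const_sub (μ.real (⋃ i, f i))
  refine tendsto_iff_dist_tendsto_zero.2 (squeeze_zero (fun _ => dist_nonneg) (fun s => ?_) hμ0)
  have hs : MeasurableSet (⋃ i ∈ s, f i) := s.measurableSet_biUnion fun i _ => hf i
  have hsub : (⋃ i ∈ s, f i) ⊆ ⋃ i, f i := Set.iUnion₂_subset fun i _ => Set.subset_iUnion f i
  have h1 := hadd _ _ hs (hU.diff hs) Set.disjoint_sdiff_right
  rw [Set.union_sdiff_cancel hsub, hfin f hf hd] at h1
  have h2 := hle _ (hU.diff hs)
  rw [measureReal_sdiff hsub hs, measureReal_biUnion_finset (fun i _ j _ hij => hd hij)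
    (fun i _ => hf i)] at h2
  rw [dist_comm, Real.dist_eq, h1, add_sub_cancel_left]
  exact h2

/-- A finitely additive set function dominated by a finite measure and with positive total mass
is positive on all non-null subsets of some non-null set. -/
lemma exists_forall_subset_pos {θ : Set S → ℝ}
    (hadd : ∀ A B, MeasurableSet A → MeasurableSet B → Disjoint A B → θ (A ∪ B) = θ A + θ B)
    (hle : ∀ A, MeasurableSet A → |θ A| ≤ μ.real A) (hpos : 0 < θ Set.univ) :
    ∃ E, MeasurableSet E ∧ 0 < μ E ∧ ∀ t, MeasurableSet t → t ⊆ E → 0 < μ t → 0 < θ t := by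
  obtain ⟨ν, hν⟩ := exists_signedMeasure_eq hadd hle
  -- Subtracting `ε • μ` before the Hahn decomposition makes positivity strict on non-null subsets
  -- of `E`; `ε` is small enough that the total stays positive, so `E` is not null.
  obtain ⟨ε, hε, hεθ⟩ : ∃ ε > 0, ε * μ.real Set.univ < θ Set.univ := by
    refine ⟨θ Set.univ / (μ.real Set.univ + 1), by positivity, ?_⟩
    rw [div_mul_eq_mul_div, div_lt_iff₀ (by positivity)]
    nlinarith
  obtain ⟨E, hE, hpE, hnE⟩ := (ν - ε • μ.toSignedMeasure).exists_compl_positive_negative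
  rw [VectorMeasure.restrict_le_restrict_iff _ _ hE] at hpE
  rw [VectorMeasure.restrict_le_restrict_iff _ _ hE.compl] at hnE
  have happ : ∀ t, MeasurableSet t → (ν - ε • μ.toSignedMeasure) t = θ t - ε * μ.real t := by
    intro t ht
    simp [hν t ht, Measure.toSignedMeasure_apply_measurable ht]
  have hsub : ∀ t, MeasurableSet t → t ⊆ E → ε * μ.real t ≤ θ t := by
    intro t ht htE
    have := hpE ht htE
    rw [happ t ht] at this
    simpa using this
  have hEc : θ Eᶜ ≤ ε * μ.real Eᶜ := by
    have := hnE hE.compl subset_rfl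
    rw [happ _ hE.compl] at this
    simpa using this
  have hposreal : ∀ t, 0 < μ t → 0 < μ.real t := fun t ht =>
    ENNReal.toReal_pos ht.ne' (measure_ne_top _ _)
  refine ⟨E, hE, ?_, fun t ht htE hμt =>
    (mul_pos hε (hposreal t hμt)).trans_le (hsub t ht htE)⟩
  rw [pos_iff_ne_zero]
  intro h0
  have h1 := hadd E Eᶜ hE hE.compl disjoint_compl_right
  rw [Set.union_compl_self] at h1
  have h2 := hle E hE
  rw [measureReal_def, h0] at h2
  have h3 : μ.real Eᶜ ≤ μ.real Set.univ := measureReal_mono (Set.subset_univ _)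
  have h4 := le_abs_self (θ E)
  have h5 := mul_le_mul_of_nonneg_left h3 hε.le
  simp only [ENNReal.toReal_zero] at h2
  linarith

end AdditiveSetFunction

/-! ### Splitting sets and cells -/

section Splitting

variable {S κ : Type*} [MeasurableSpace S] [Countable κ] {Q : Measure (ℕ → S)}
  [IsProbabilityMeasure Q] {μ : Measure S} [IsProbabilityMeasure μ] {C : κ → Set S}
  {z : Set S → ℝ × ℝ}

/-- The bound on the first coordinate rests on the ergodic theorem: the frequency of `C k ∩ A` is at
most that of `A`, which tends to `μ A`. -/
lemma IsClusterProfile.mem_Icc (hQ : Ergodic shift Q) (hμ : ∀ i, Q.map (fun x => x i) = μ)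
    (hz : IsClusterProfile Q μ C z) {A : Set S} (hA : MeasurableSet A) :
    (0 ≤ (z A).1 ∧ (z A).1 ≤ μ.real A) ∧ 0 ≤ (z A).2 ∧ (z A).2 ≤ μ.real A := by
  have key : ∀ ε > 0, (0 ≤ (z A).1 + ε ∧ (z A).1 ≤ μ.real A + ε) ∧
      0 ≤ (z A).2 + ε ∧ (z A).2 ≤ μ.real A + ε := by
    intro ε hε
    obtain ⟨m, k, x, h⟩ := hz.exists_sample hQ hμ {A} (by simpa using hA) (half_pos hε)
    obtain ⟨h1, h2, h3, -, -⟩ := h A (by simp)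
    rw [abs_lt] at h1 h2 h3
    have h4 := empFreq_nonneg (C k ∩ A) m x
    have h5 := empFreq_mono (Set.inter_subset_right : C k ∩ A ⊆ A) m x
    have h6 : 0 ≤ μ.real (C k ∩ A) := measureReal_nonneg
    have h7 : μ.real (C k ∩ A) ≤ μ.real A := measureReal_mono Set.inter_subset_right
    exact ⟨⟨by linarith, by linarith⟩, by linarith, by linarith⟩
  exact ⟨⟨le_of_forall_pos_le_add fun ε hε => (key ε hε).1.1,
    le_of_forall_pos_le_add fun ε hε => (key ε hε).1.2⟩,
    le_of_forall_pos_le_add fun ε hε => (key ε hε).2.1,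
    le_of_forall_pos_le_add fun ε hε => (key ε hε).2.2⟩

lemma IsClusterProfile.union (hQ : Ergodic shift Q) (hμ : ∀ i, Q.map (fun x => x i) = μ)
    (hC : ∀ k, MeasurableSet (C k)) (hz : IsClusterProfile Q μ C z) {A B : Set S}
    (hA : MeasurableSet A) (hB : MeasurableSet B) (hAB : Disjoint A B) :
    z (A ∪ B) = z A + z B := by
  classical
  have key : ∀ ε > 0, |(z (A ∪ B)).1 - ((z A).1 + (z B).1)| ≤ ε ∧
      |(z (A ∪ B)).2 - ((z A).2 + (z B).2)| ≤ ε := by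
    intro ε hε
    obtain ⟨m, k, x, h⟩ := hz.exists_sample hQ hμ {A, B, A ∪ B}
      (by simp [hA, hB, hA.union hB]) (div_pos hε three_pos)
    obtain ⟨a1, a2, -⟩ := h A (by simp)
    obtain ⟨b1, b2, -⟩ := h B (by simp)
    obtain ⟨c1, c2, -⟩ := h (A ∪ B) (by simp)
    have hd : Disjoint (C k ∩ A) (C k ∩ B) :=
      hAB.mono Set.inter_subset_right Set.inter_subset_right
    rw [Set.inter_union_distrib_left, empFreq_union hd] at c1
    rw [Set.inter_union_distrib_left, measureReal_union hd ((hC k).inter hB)] at c2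
    rw [abs_lt] at a1 a2 b1 b2 c1 c2
    constructor <;> rw [abs_le] <;> constructor <;> linarith
  refine Prod.ext (sub_eq_zero.1 ?_) (sub_eq_zero.1 ?_)
  · exact abs_eq_zero.1 (le_antisymm (le_of_forall_pos_le_add fun ε hε => by
      simpa using (key ε hε).1) (abs_nonneg _))
  · exact abs_eq_zero.1 (le_antisymm (le_of_forall_pos_le_add fun ε hε => by
      simpa using (key ε hε).2) (abs_nonneg _))

/-- If frequencies and measures have different limits on the sets in `F`, then a single member of
the family splits all of them. -/
lemma IsClusterProfile.exists_split (hQ : Ergodic shift Q) (hμ : ∀ i, Q.map (fun x => x i) = μ)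
    (hC : ∀ k, MeasurableSet (C k)) (hz : IsClusterProfile Q μ C z) (F : Finset (Set S))
    (hF : ∀ A ∈ F, MeasurableSet A) (hne : ∀ A ∈ F, (z A).1 ≠ (z A).2) :
    ∃ k, ∀ A ∈ F, 0 < μ (C k ∩ A) ∧ 0 < μ (A \ C k) := by
  -- A gap of `2 * ε` suffices: in the two excluded cases both coordinates lie in `[0, ε)` or in `(μ
  -- A - 2 * ε, μ A]`.
  obtain ⟨ε, hε, hεF⟩ : ∃ ε > 0, ∀ A ∈ F, 2 * ε < |(z A).1 - (z A).2| := by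
    have : ∀ᶠ ε in 𝓝[>] (0 : ℝ), ∀ A ∈ F, 2 * ε < |(z A).1 - (z A).2| := by
      refine (Finset.eventually_all F).2 fun A hA => ?_
      have hpos : 0 < |(z A).1 - (z A).2| := abs_pos.2 (sub_ne_zero.2 (hne A hA))
      have hcont : Tendsto (fun ε : ℝ => 2 * ε) (𝓝[>] 0) (𝓝 (2 * 0)) :=
        (tendsto_id.const_mul 2).mono_left nhdsWithin_le_nhds
      exact hcont.eventually (gt_mem_nhds (by simpa using hpos))
    obtain ⟨ε, h1, h2⟩ := (this.and self_mem_nhdsWithin).exists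
    exact ⟨ε, h2, h1⟩
  obtain ⟨m, k, x, h⟩ := hz.exists_sample hQ hμ F hF hε
  refine ⟨k, fun A hA => ?_⟩
  obtain ⟨h1, h2, h3, h4, h5⟩ := h A hA
  obtain ⟨⟨b1, b2⟩, b3, b4⟩ := hz.mem_Icc hQ hμ (hF A hA)
  have hgap := hεF A hA
  rw [abs_lt] at h1 h2 h3
  constructor <;> rw [pos_iff_ne_zero] <;> intro h0
  · have e1 := h4 h0
    have e2 : μ.real (C k ∩ A) = 0 := by rw [measureReal_def, h0, ENNReal.toReal_zero]
    rcases lt_abs.1 hgap with hg | hg <;> linarith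
  · have e1 := h5 h0
    have e2 : μ.real (A \ C k) = 0 := by rw [measureReal_def, h0, ENNReal.toReal_zero]
    have e3 : empFreq A m x = empFreq (C k ∩ A) m x + empFreq (A \ C k) m x := by
      rw [← empFreq_union (Set.disjoint_sdiff_right.mono_left Set.inter_subset_left),
        Set.inter_comm, Set.inter_union_sdiff]
    have e4 : μ.real A = μ.real (C k ∩ A) + μ.real (A \ C k) := by
      rw [Set.inter_comm, measureReal_inter_add_sdiff (hC k)]
    rcases lt_abs.1 hgap with hg | hg <;> linarith

lemma IsClusterProfile.exists_forall_subset_ne (hQ : Ergodic shift Q)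
    (hμ : ∀ i, Q.map (fun x => x i) = μ) (hC : ∀ k, MeasurableSet (C k))
    (hz : IsClusterProfile Q μ C z) (hne : (z Set.univ).1 ≠ (z Set.univ).2) :
    ∃ E, MeasurableSet E ∧ 0 < μ E ∧
      ∀ t, MeasurableSet t → t ⊆ E → 0 < μ t → (z t).1 ≠ (z t).2 := by
  rcases lt_or_gt_of_ne hne with hlt | hlt
  · obtain ⟨E, hE, hE0, h⟩ := exists_forall_subset_pos (μ := μ) (θ := fun A => (z A).2 - (z A).1)
      (fun A B hA hB hAB => by
        simp only [hz.union hQ hμ hC hA hB hAB, Prod.fst_add, Prod.snd_add]; ring)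
      (fun A hA => by
        obtain ⟨⟨b1, b2⟩, b3, b4⟩ := hz.mem_Icc hQ hμ hA
        exact abs_le.2 ⟨by linarith, by linarith⟩) (sub_pos.2 hlt)
    exact ⟨E, hE, hE0, fun t ht htE h0 => (sub_pos.1 (h t ht htE h0)).ne⟩
  · obtain ⟨E, hE, hE0, h⟩ := exists_forall_subset_pos (μ := μ) (θ := fun A => (z A).1 - (z A).2)
      (fun A B hA hB hAB => by
        simp only [hz.union hQ hμ hC hA hB hAB, Prod.fst_add, Prod.snd_add]; ring)
      (fun A hA => by
        obtain ⟨⟨b1, b2⟩, b3, b4⟩ := hz.mem_Icc hQ hμ hA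
        exact abs_le.2 ⟨by linarith, by linarith⟩) (sub_pos.2 hlt)
    exact ⟨E, hE, hE0, fun t ht htE h0 => (sub_pos.1 (h t ht htE h0)).ne'⟩

/-- The cell of the join of `A` selected by `τ`. -/
def cell {S : Type*} {k : ℕ} (A : Fin k → Set S) (τ : Fin k → Bool) : Set S :=
  ⋂ i, if τ i then A i else (A i)ᶜ

lemma IsClusterProfile.exists_cell_pos (hQ : Ergodic shift Q)
    (hμ : ∀ i, Q.map (fun x => x i) = μ) (hC : ∀ k, MeasurableSet (C k))
    (hz : IsClusterProfile Q μ C z) (hne : (z Set.univ).1 ≠ (z Set.univ).2) (L : ℕ) :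
    ∃ D : Fin L → κ, ∀ τ, 0 < μ (cell (fun i => C (D i)) τ) := by
  classical
  obtain ⟨E, hE, hE0, hEne⟩ := hz.exists_forall_subset_ne hQ hμ hC hne
  -- Intersecting with `E` keeps every cell where the coordinates of `z` differ, so one `C k` splits
  -- all of them in the inductive step.
  suffices h : ∃ D : Fin L → κ, ∀ τ, 0 < μ (cell (fun i => C (D i)) τ ∩ E) from
    h.imp fun D hD τ => (hD τ).trans_le (measure_mono Set.inter_subset_left)
  induction L with
  | zero => exact ⟨Fin.elim0, fun τ => by simpa [cell] using hE0⟩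
  | succ L ih =>
    obtain ⟨D, hD⟩ := ih
    have hmeas : ∀ τ, MeasurableSet (cell (fun i => C (D i)) τ ∩ E) := fun τ =>
      (MeasurableSet.iInter fun i => by
        split_ifs
        exacts [hC _, (hC _).compl]).inter hE
    obtain ⟨k, hk⟩ := hz.exists_split hQ hμ hC
      (Finset.univ.image fun τ => cell (fun i => C (D i)) τ ∩ E)
      (by simpa using hmeas)
      (by simpa using fun τ => hEne _ (hmeas τ) Set.inter_subset_right (hD τ))
    refine ⟨Fin.cons k D, fun τ => ?_⟩
    obtain ⟨h1, h2⟩ := hk _ (Finset.mem_image_of_mem _ (Finset.mem_univ (fun i => τ i.succ)))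
    have hcell : cell (fun i => C ((Fin.cons k D : Fin (L + 1) → κ) i)) τ =
        (if τ 0 then C k else (C k)ᶜ) ∩ cell (fun i => C (D i)) fun i => τ i.succ := by
      ext s
      simp [cell, Fin.forall_fin_succ]
    rw [hcell, Set.inter_assoc]
    cases τ 0 with
    | true => simpa using h1
    | false => simpa [Set.sdiff_eq, Set.inter_comm] using h2

end Splitting

/-! ### Full joins and shattering -/

section Combinatorics

variable {S : Type*}

lemma mem_cell {k : ℕ} {A : Fin k → Set S} {τ : Fin k → Bool} {s : S} :
    s ∈ cell A τ ↔ ∀ i, s ∈ A i ↔ τ i = true := by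
  simp only [cell, Set.mem_iInter]
  refine forall_congr' fun i => ?_
  cases τ i <;> simp

lemma join_eq_range_cell {k : ℕ} {A : Fin k → Set S} (h : ∀ τ, (cell A τ).Nonempty) :
    join A = Set.range (cell A) := by
  classical
  ext E
  constructor
  · rintro ⟨-, B, hB, rfl⟩
    refine ⟨fun i => decide (B i = A i), Set.iInter_congr fun i => ?_⟩
    by_cases hi : B i = A i
    · simp [hi]
    · simp [(hB i).resolve_left hi, (hB i).resolve_left hi ▸ hi]
  · rintro ⟨τ, rfl⟩
    exact ⟨h τ, _, fun i => by cases τ i <;> simp, rfl⟩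

lemma isFullJoin_of_cell_nonempty {k : ℕ} {A : Fin k → Set S} (h : ∀ τ, (cell A τ).Nonempty) :
    IsFullJoin A := by
  have hinj : Function.Injective (cell A) := by
    intro τ τ' hττ'
    obtain ⟨s, hs⟩ := h τ
    have hs' := hs
    rw [hττ'] at hs'
    funext i
    exact Bool.eq_iff_iff.2 ((mem_cell.1 hs i).symm.trans (mem_cell.1 hs' i))
  rw [IsFullJoin, join_eq_range_cell h, ← Set.image_univ, Set.ncard_image_of_injective _ hinj,
    Set.ncard_univ, Nat.card_eq_fintype_card]
  simp

/-- A family containing `2 ^ L` sets all of whose cells are nonempty shatters `L` points. -/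
lemma exists_shatterCoeff_eq {𝒞 : Set (Set S)} {L : ℕ} {D : Fin (2 ^ L) → Set S}
    (hD : ∀ i, D i ∈ 𝒞) (h : ∀ τ, (cell D τ).Nonempty) :
    ∃ F : Finset S, F.card = L ∧ shatterCoeff F 𝒞 = 2 ^ F.card := by
  classical
  -- Dual shattering: the sets are indexed by the subsets `τ` of `Fin L`, and `x j` is picked in the
  -- cell lying inside exactly those sets whose `τ` contains `j`.
  have e : (Fin L → Bool) ≃ Fin (2 ^ L) := Fintype.equivFinOfCardEq (by simp)
  choose x hx using fun j : Fin L => h fun i => e.symm i j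
  have hmem : ∀ j τ, x j ∈ D (e τ) ↔ τ j = true := fun j τ => by
    simpa using mem_cell.1 (hx j) (e τ)
  have hinj : Function.Injective x := by
    intro j j' hjj'
    have h1 := (hmem j fun l => decide (l = j)).2 (by simp)
    rw [hjj', hmem] at h1
    exact (of_decide_eq_true h1).symm
  refine ⟨Finset.univ.image x, by simp [Finset.card_image_of_injective _ hinj], ?_⟩
  have himage : (fun C : Set S => C ∩ (Finset.univ.image x : Finset S)) '' 𝒞 =
      Set.powerset ((Finset.univ.image x : Finset S) : Set S) := by
    refine Set.Subset.antisymm (Set.image_subset_iff.2 fun C _ => Set.inter_subset_right) ?_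
    intro B hB
    refine ⟨D (e fun j => decide (x j ∈ B)), hD _, ?_⟩
    ext s
    constructor
    · rintro ⟨h1, h2⟩
      obtain ⟨j, -, rfl⟩ := Finset.mem_image.1 (Finset.mem_coe.1 h2)
      exact of_decide_eq_true ((hmem _ _).1 h1)
    · intro hs
      refine ⟨?_, hB hs⟩
      obtain ⟨j, -, rfl⟩ := Finset.mem_image.1 (Finset.mem_coe.1 (hB hs))
      exact (hmem _ _).2 (decide_eq_true hs)
  rw [shatterCoeff, himage, Set.ncard_powerset _ (Finset.finite_toSet _), Set.ncard_coe_finset]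

end Combinatorics

lemma IsFiniteUnionOfIntervals.measurableSet {C : Set I} (h : IsFiniteUnionOfIntervals C) :
    MeasurableSet C := by
  obtain ⟨J, hJ, hJo, rfl⟩ := h
  exact .sUnion hJ.countable fun t ht => (hJo t ht).measurableSet

/-! ### Transfer to path space -/

section PathLaw

variable {Ω S : Type*} [MeasurableSpace Ω] [MeasurableSpace S] {P : Measure Ω} {X : ℕ → Ω → S}

lemma map_apply_pathLaw (hX : ∀ i, Measurable (X i)) (i : ℕ) :
    (pathLaw X P).map (fun x => x i) = P.map (X i) := by
  rw [pathLaw, Measure.map_map (measurable_pi_apply i) (measurable_pi_lambda _ hX)]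
  rfl

lemma isProbabilityMeasure_pathLaw [IsProbabilityMeasure P] (hX : ∀ i, Measurable (X i)) :
    IsProbabilityMeasure (pathLaw X P) :=
  Measure.isProbabilityMeasure_map (measurable_pi_lambda _ hX).aemeasurable

lemma discrepancy_eq (hX : ∀ i, Measurable (X i)) {C : Set S} (hC : MeasurableSet C) (m : ℕ)
    (ω : Ω) : discrepancy X P C m ω =
      |empFreq C m (fun n => X n ω) - (P.map (X 0)).real C| := by
  rw [map_measureReal_apply (hX 0) hC]
  rfl

/-- If the uniform discrepancy does not vanish asymptotically, it exceeds a fixed level with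
positive probability. -/
lemma exists_not_ae_eventually_lt (hX : ∀ i, Measurable (X i)) {𝒞 : Set (Set S)}
    (h𝒞 : ∀ C ∈ 𝒞, MeasurableSet C)
    (hpos : 0 < P {ω | 0 < limsup (fun m : ℕ => Gamma 𝒞 X P m ω) atTop}) :
    ∃ δ > 0, ¬ ∀ᵐ x ∂(pathLaw X P), ∀ᶠ m in atTop, ∀ C : 𝒞,
      |empFreq (C : Set S) m x - (P.map (X 0)).real C| < δ := by
  by_contra! hcon
  refine hpos.ne' ?_
  have hall : ∀ᵐ ω ∂P, ∀ n : ℕ, ∀ᶠ m in atTop, ∀ C : 𝒞,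
      |empFreq (C : Set S) m (fun n => X n ω) - (P.map (X 0)).real C| < 1 / ((n : ℝ) + 1) :=
    ae_all_iff.2 fun n => ae_of_ae_map (measurable_pi_lambda _ hX).aemeasurable
      (hcon _ Nat.one_div_pos_of_nat)
  have hle : ∀ᵐ ω ∂P, ¬ 0 < limsup (fun m : ℕ => Gamma 𝒞 X P m ω) atTop := by
    filter_upwards [hall] with ω hω
    rw [not_lt]
    refine ge_of_tendsto' tendsto_one_div_add_atTop_nhds_zero_nat fun n => ?_
    -- A real `limsup` needs a coboundedness proof, supplied by `0 ≤ Gamma`. Nonnegativity of the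
    -- bound covers the empty family, whose supremum is `0`.
    refine limsup_le_of_le ?_ ((hω n).mono fun m hm =>
      Real.iSup_le (fun C => ?_) Nat.one_div_pos_of_nat.le)
    · exact IsBoundedUnder.isCoboundedUnder_le
        ⟨0, eventually_map.2 (.of_forall fun m => Real.iSup_nonneg fun C => abs_nonneg _)⟩
    · rw [discrepancy_eq hX (h𝒞 C C.2)]
      exact (hm C).le
  simpa [ae_iff] using hle

end PathLaw

end UniformErgodic

/-! ### The main theorem -/

open UniformErgodic in
theorem mainTheorem2 {Ω : Type*} [MeasurableSpace Ω] (P : Measure Ω) [IsProbabilityMeasure P]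
    (X : ℕ → Ω → I) (hX : ∀ i, Measurable (X i))
    (hstat : UniformErgodic.IsStationary X P) (herg : UniformErgodic.IsErgodic X P)
    (hunif : ∀ i, P.map (X i) = (volume : Measure I))
    (𝒞₀ : Set (Set I)) (hcount : 𝒞₀.Countable)
    (hint : ∀ C ∈ 𝒞₀, UniformErgodic.IsFiniteUnionOfIntervals C)
    (hpos : 0 < P {ω | 0 < limsup (fun m : ℕ => UniformErgodic.Gamma 𝒞₀ X P m ω) atTop}) :
    (∀ L : ℕ, 1 ≤ L → ∃ D : Fin L → Set I, (∀ i, D i ∈ 𝒞₀) ∧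
      UniformErgodic.IsFullJoin D ∧
      ∀ B ∈ UniformErgodic.join D, 0 < (volume : Measure I) B) ∧
    UniformErgodic.vcDim 𝒞₀ = ⊤ := by
  have hmeas : ∀ C ∈ 𝒞₀, MeasurableSet C := fun C hC => (hint C hC).measurableSet
  have : Countable 𝒞₀ := hcount.to_subtype
  have := isProbabilityMeasure_pathLaw (P := P) hX
  have hQ : Ergodic shift (pathLaw X P) := ⟨hstat, herg⟩
  have hμ : ∀ i, (pathLaw X P).map (fun x => x i) = (volume : Measure I) := fun i => by
    rw [map_apply_pathLaw hX, hunif]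
  obtain ⟨δ, hδ, hnot⟩ := exists_not_ae_eventually_lt hX hmeas hpos
  rw [hunif 0] at hnot
  obtain ⟨z, hz, hzδ⟩ := exists_isClusterProfile (κ := 𝒞₀) (C := fun C : 𝒞₀ => (C : Set I)) herg
    (fun C => hmeas C C.2) hnot
  have hne : (z Set.univ).1 ≠ (z Set.univ).2 :=
    sub_ne_zero.1 (abs_pos.1 (hδ.trans_le hzδ))
  have hcells : ∀ L : ℕ, ∃ D : Fin L → Set I, (∀ i, D i ∈ 𝒞₀) ∧
      ∀ τ, 0 < (volume : Measure I) (cell D τ) := fun L => by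
    obtain ⟨D, hD⟩ := hz.exists_cell_pos hQ hμ (fun C : 𝒞₀ => hmeas C C.2) hne L
    exact ⟨fun i => D i, fun i => (D i).2, hD⟩
  refine ⟨fun L _ => ?_, ?_⟩
  · obtain ⟨D, hD, hcell⟩ := hcells L
    have hnonempty : ∀ τ, (cell D τ).Nonempty := fun τ => nonempty_of_measure_ne_zero (hcell τ).ne'
    refine ⟨D, hD, isFullJoin_of_cell_nonempty hnonempty, ?_⟩
    rw [join_eq_range_cell hnonempty]
    rintro _ ⟨τ, rfl⟩
    exact hcell τ
  · refine ENat.eq_top_iff_forall_ge.2 fun L => ?_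
    obtain ⟨D, hD, hcell⟩ := hcells (2 ^ L)
    obtain ⟨F, hF, hshatter⟩ := exists_shatterCoeff_eq hD fun τ =>
      nonempty_of_measure_ne_zero (hcell τ).ne'
    rw [← hF]
    exact le_iSup₂_of_le F hshatter le_rfl
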